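/- Let $X$ be a partially (for instance totally) ordered set with a greatest and a least element, let $d\in\mathbb N$, and order $X^d$ coordinatewise. For $x,x'\in X^d$ let $\Delta(x,x')=\{i\in[d] : x_i\neq x'_i\}$. For $f:X^d\to\{0,1\}$ and $x^\star\in X^d$, a counterfactual for $x^\star$ is an $x'\in X^d$ with $f(x')\neq f(x^\star)$. When one exists, put $\Delta_f(x^\star)=\min\{|\Delta(x^\star,x')| : f(x')\ne f(x^\star)\}$, call a counterfactual $x'$ optimal if $|\Delta(x^\star,x')|=\Delta_f(x^\star)$, and let $$\mathcal C_f(x^\star)=\{\Delta(x^\star,x') : x' \text{ is an optimal counterfactual for } x^\star\}.$$ The sensitivity of $f$ is $S(f)=\max_{x\in X^d}|\{i\in[d] : \exists a\in X,\ f(x)\ne f(x_{i\leftarrow a})\}|$, where $x_{i\leftarrow a}$ is $x$ with its $i$-th coordinate set to $a$. **Theorem.** For every $c\in\mathbb N$ there is a constant $C\in\mathbb N$ such that for all $X$ and $d$ as above there is a randomized adaptive query algorithm with the following property. For every monotone non-constant $f:X^d\to\{0,1\}$ and every $x^\star\in X^d$, given $x^\star$ and query access to $f$ (and no further information on $f$,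 in particular neither $S(f)$ nor $\Delta_f(x^\star)$), the algorithm always makes at most $$C\cdot S(f)^{C\,\Delta_f(x^\star)}\cdot\log d$$ queries to $f$, and with probability at least $1-d^{-c}$ it returns $\mathcal C_f(x^\star)$. -/

import Mathlib

namespace Counterfactual

open Classical in
/-- `Δ(x, x')`: the set of features on which the instances `x` and `x'` differ. -/
noncomputable def featureDiff {X : Type*} {d : ℕ} (x x' : Fin d → X) : Finset (Fin d) :=
  Finset.univ.filter fun i => x i ≠ x' i

/-- `x'` is a counterfactual for `x` with respect to the model `f`. -/
def IsCounterfactual {X : Type*} {d : ℕ} (f : (Fin d → X) → Bool) (x x' : Fin d → X) : Prop :=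
  f x ≠ f x'

/-- The counterfactual complexity `Δ_f(x)`: the least sparsity `|Δ(x, x')|` of a counterfactual
`x'` for `x`. It is meaningful when `x` has a counterfactual, that is, when `f` is not constant. -/
noncomputable def complexity {X : Type*} {d : ℕ} (f : (Fin d → X) → Bool) (x : Fin d → X) : ℕ :=
  sInf {k : ℕ | ∃ x', IsCounterfactual f x x' ∧ (featureDiff x x').card = k}

/-- `x'` is an optimal counterfactual for `x`: a counterfactual whose sparsity is `Δ_f(x)`. -/
def IsOptimal {X : Type*} {d : ℕ} (f : (Fin d → X) → Bool) (x x' : Fin d → X) : Prop :=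
  IsCounterfactual f x x' ∧ (featureDiff x x').card = complexity f x

open Classical in
/-- `𝒞_f(x)`: the collection of the sets `Δ(x, x')`, over all optimal counterfactuals `x'`
for `x`. -/
noncomputable def optimalSets {X : Type*} {d : ℕ} (f : (Fin d → X) → Bool) (x : Fin d → X) :
    Finset (Finset (Fin d)) :=
  Finset.univ.filter fun D => ∃ x', IsOptimal f x x' ∧ featureDiff x x' = D

open Classical in
/-- The sensitivity `S_f(x)` of `f` at `x`: the number of features `i` such that changing `x i`
alone, to some value, flips the value of `f`. -/
noncomputable def sensitivityAt {X : Type*} {d : ℕ} (f : (Fin d → X) → Bool) (x : Fin d → X) :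
    ℕ :=
  (Finset.univ.filter fun i : Fin d => ∃ a : X, f x ≠ f (Function.update x i a)).card

/-- The sensitivity `S(f)`: the maximum of `S_f(x)` over all instances `x` (the values are
bounded by `d`, so that the supremum is a maximum). -/
noncomputable def sensitivity {X : Type*} {d : ℕ} (f : (Fin d → X) → Bool) : ℕ :=
  ⨆ x, sensitivityAt f x

/-- A deterministic query algorithm (adaptive decision tree): it either stops with an output, or
queries the unknown model at an instance and continues according to the answer. -/
inductive QueryTree (I : Type*) (O : Type*) : Type _
  | output : O → QueryTree I O
  | query : I → (Bool → QueryTree I O) → QueryTree I O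

/-- The output of the algorithm when its queries are answered by `f`. -/
def QueryTree.run {I O : Type*} (f : I → Bool) : QueryTree I O → O
  | .output o => o
  | .query z next => (next (f z)).run f

/-- The number of queries the algorithm makes when they are answered by `f`. -/
def QueryTree.numQueries {I O : Type*} (f : I → Bool) : QueryTree I O → ℕ
  | .output _ => 0
  | .query z next => (next (f z)).numQueries f + 1

/-- A randomized query algorithm: a probability distribution over deterministic ones (the random
choices are independent of the unknown model). -/
abbrev RandomizedAlgorithm (I : Type*) (O : Type*) : Type _ := PMF (QueryTree I O)

/-- The distribution of the output of a randomized query algorithm run on `f`. -/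
noncomputable def RandomizedAlgorithm.outputDist {I O : Type*} (A : RandomizedAlgorithm I O)
    (f : I → Bool) : PMF O :=
  PMF.map (fun t => t.run f) A

/-- Every possible execution of the randomized query algorithm on `f` makes at most `q`
queries. -/
def RandomizedAlgorithm.QueriesAtMost {I O : Type*} (A : RandomizedAlgorithm I O)
    (f : I → Bool) (q : ℝ) : Prop :=
  ∀ t ∈ PMF.support A, (t.numQueries f : ℝ) ≤ q

end Counterfactual

/-! For monotone `f`, the values on changed features may be taken extreme: if the features in `D`
can be changed so as to flip the label of `x`, moving them all to the bound opposite to that label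
flips it too. So `flips f x` is a monotone Boolean function `g` on subsets of `[d]`, and the task is
to list its smallest true sets (`optimalSets_eq`).

These are found level by level. Each optimal set stays above some stored set `P` of size `j`. If `H`
has a false complement, every true set meets `H`; so the sets `P ∪ {h}`, `h ∈ H`, serve for the next
level. A greedy `H` has at most `S(f)` elements, each found by a bisection with about `log₂ d`
queries (`hittingSet_spec`). Hence level `j` holds at most `S(f)^j` sets (`levelSearch_spec`), and
the remaining factor `Δ_f(x)` is absorbed by `Δ_f(x) ≤ S(f)`. The method is deterministic and never
errs. -/

namespace Counterfactual

/-! ### Decision trees: composition, cost and bisection. -/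

namespace QueryTree

variable {I J O O' A : Type*}

/-- Run one algorithm, then another one that depends on the output of the first. -/
def bind : QueryTree I O → (O → QueryTree I O') → QueryTree I O'
  | .output o, k => k o
  | .query z next, k => .query z fun r => (next r).bind k

@[simp] theorem run_output (f : I → Bool) (o : O) : (output o : QueryTree I O).run f = o := rfl

@[simp] theorem run_query (f : I → Bool) (z : I) (next : Bool → QueryTree I O) :
    (query z next).run f = (next (f z)).run f := rfl

@[simp] theorem numQueries_output (f : I → Bool) (o : O) :
    (output o : QueryTree I O).numQueries f = 0 := rfl

@[simp] theorem numQueries_query (f : I → Bool) (z : I) (next : Bool → QueryTree I O) :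
    (query z next).numQueries f = (next (f z)).numQueries f + 1 := rfl

@[simp] theorem run_bind (f : I → Bool) (t : QueryTree I O) (k : O → QueryTree I O') :
    (t.bind k).run f = (k (t.run f)).run f := by
  induction t with
  | output o => rfl
  | query z next ih => exact ih _

@[simp] theorem numQueries_bind (f : I → Bool) (t : QueryTree I O) (k : O → QueryTree I O') :
    (t.bind k).numQueries f = t.numQueries f + (k (t.run f)).numQueries f := by
  induction t with
  | output o => simp [bind]
  | query z next ih =>
    simp only [bind, numQueries_query, run_query, ih]
    omega

/-- Run an algorithm on every entry of a list and collect the outputs. -/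
def traverse (t : A → QueryTree I O) : List A → QueryTree I (List O)
  | [] => .output []
  | a :: l => (t a).bind fun o => (traverse t l).bind fun os => .output (o :: os)

@[simp] theorem run_traverse (f : I → Bool) (t : A → QueryTree I O) (l : List A) :
    (traverse t l).run f = l.map fun a => (t a).run f := by
  induction l with
  | nil => rfl
  | cons a l ih => simp [traverse, ih]

theorem numQueries_traverse_le (f : I → Bool) (t : A → QueryTree I O) (l : List A) (q : ℕ)
    (h : ∀ a ∈ l, (t a).numQueries f ≤ q) : (traverse t l).numQueries f ≤ l.length * q := by
  induction l with
  | nil => simp [traverse]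
  | cons a l ih =>
    have h₁ := h a (by simp)
    have h₂ := ih fun b hb => h b (by simp [hb])
    simp only [traverse, numQueries_bind, numQueries_output, List.length_cons, add_mul, one_mul]
    omega

/-- Replace every query `z` by the query `φ z`, whose answer is read up to the flip `b`. -/
def translate (φ : I → J) (b : Bool) : QueryTree I O → QueryTree J O
  | .output o => .output o
  | .query z next => .query (φ z) fun r => (next (r ^^ b)).translate φ b

theorem run_translate (φ : I → J) (b : Bool) (f : J → Bool) (t : QueryTree I O) :
    (t.translate φ b).run f = t.run fun z => f (φ z) ^^ b := by
  induction t with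
  | output o => rfl
  | query z next ih => exact ih _

theorem numQueries_translate (φ : I → J) (b : Bool) (f : J → Bool) (t : QueryTree I O) :
    (t.translate φ b).numQueries f = t.numQueries fun z => f (φ z) ^^ b := by
  induction t with
  | output o => rfl
  | query z next ih => exact congrArg (· + 1) (ih _)

/-- Bisection on the interval `[lo, lo + 2 ^ L]` for a place where the answer drops from `true`
to `false`. -/
def bisect (q : ℕ → I) : ℕ → ℕ → QueryTree I ℕ
  | 0, lo => .output lo
  | L + 1, lo => .query (q (lo + 2 ^ L)) fun r =>
      if r then bisect q L (lo + 2 ^ L) else bisect q L lo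

theorem numQueries_bisect (f : I → Bool) (q : ℕ → I) (L lo : ℕ) :
    (bisect q L lo).numQueries f = L := by
  induction L generalizing lo with
  | zero => rfl
  | succ L ih =>
    simp only [bisect, numQueries_query]
    split <;> rw [ih]

/-- The invariant "true at the left end, false at the right end" survives each halving, so
monotonicity along `q` is not needed. -/
theorem bisect_spec (f : I → Bool) (q : ℕ → I) (L lo : ℕ) (h₀ : f (q lo) = true)
    (h₁ : f (q (lo + 2 ^ L)) = false) :
    f (q ((bisect q L lo).run f)) = true ∧ f (q ((bisect q L lo).run f + 1)) = false := by
  induction L generalizing lo with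
  | zero => exact ⟨h₀, h₁⟩
  | succ L ih =>
    simp only [bisect, run_query]
    split
    · next h =>
      refine ih _ h ?_
      rwa [add_assoc, ← two_mul, ← pow_succ']
    · next h => exact ih _ h₀ (by simpa using h)

end QueryTree

/-! ### Smallest true sets of a monotone function on the subsets of `[d]`. -/

section Cube

variable {d : ℕ}

/-- Remove from `H`'s complement the elements outside `P` that are smaller than `m`. -/
def cutBelow (P H : Finset (Fin d)) (m : ℕ) : Finset (Fin d) :=
  Finset.univ.filter fun i => i ∉ H ∧ (i ∈ P ∨ m ≤ i.val)

theorem mem_cutBelow {P H : Finset (Fin d)} {m : ℕ} {i : Fin d} :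
    i ∈ cutBelow P H m ↔ i ∉ H ∧ (i ∈ P ∨ m ≤ i.val) := by
  simp [cutBelow]

/-- Extend `H` greedily to a minimal set, disjoint from `P`, whose complement has value `false`. -/
def hittingSet (L : ℕ) (P : Finset (Fin d)) :
    ℕ → Finset (Fin d) → QueryTree (Finset (Fin d)) (Finset (Fin d))
  | 0, H => .output H
  | n + 1, H => .query Hᶜ fun r =>
      if r then
        (QueryTree.bisect (cutBelow P H) L 0).bind fun m =>
          hittingSet L P n (if h : m < d then insert ⟨m, h⟩ H else H)
      else .output H

/-- The set `cutBelow P H b` witnesses that `H` is small: it is false, and adding any `h ∈ H` makes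
it true. Each new element lies below the threshold `b` and becomes the next threshold, so `n ≥ b`
rounds suffice. It costs one test and `L` bisection queries; one last test may follow. -/
theorem hittingSet_spec {g : Finset (Fin d) → Bool} (hg : Monotone g) {s : ℕ}
    (hs : ∀ D H : Finset (Fin d), g D = false → (∀ h ∈ H, g (insert h D) = true) → H.card ≤ s)
    {L : ℕ} (hL : d ≤ 2 ^ L) {P : Finset (Fin d)} (n : ℕ) (H : Finset (Fin d)) (b : ℕ)
    (hbn : b ≤ n) (hbd : b ≤ d) (hPH : Disjoint H P) (hlow : g (cutBelow P H b) = false)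
    (hsens : ∀ h ∈ H, g (insert h (cutBelow P H b)) = true) :
    g ((hittingSet L P n H).run g)ᶜ = false ∧ Disjoint ((hittingSet L P n H).run g) P ∧
      ((hittingSet L P n H).run g).card ≤ s ∧
      (hittingSet L P n H).numQueries g + H.card * (L + 1) ≤
        ((hittingSet L P n H).run g).card * (L + 1) + 1 := by
  have up : ∀ {D E : Finset (Fin d)}, D ⊆ E → g D = true → g E = true := fun h h' =>
    hg h h'
  induction n generalizing H b with
  | zero =>
    obtain rfl : b = 0 := by omega
    have hH : cutBelow P H 0 = Hᶜ := by ext i; simp [mem_cutBelow]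
    refine ⟨?_, hPH, hs _ H hlow hsens, ?_⟩
    · simpa only [hittingSet, QueryTree.run_output, hH] using hlow
    · simp [hittingSet]
  | succ n ih =>
    have h0 : cutBelow P H 0 = Hᶜ := by ext i; simp [mem_cutBelow]
    simp only [hittingSet, QueryTree.run_query, QueryTree.numQueries_query]
    cases hc : g Hᶜ with
    | false =>
      simp only [Bool.false_eq_true, if_false, QueryTree.run_output, QueryTree.numQueries_output]
      exact ⟨hc, hPH, hs _ H hlow hsens, by omega⟩
    | true =>
      have anti : ∀ {m m' : ℕ}, m ≤ m' → cutBelow P H m' ⊆ cutBelow P H m := by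
        intro m m' hm i
        simp only [mem_cutBelow]
        rintro ⟨h₁, h₂⟩
        exact ⟨h₁, h₂.imp id hm.trans⟩
      have hfar : ∀ m, b ≤ m → g (cutBelow P H m) = false := by
        intro m hm
        by_contra h
        rw [Bool.not_eq_false] at h
        simp [up (anti hm) h] at hlow
      obtain ⟨ht, hf⟩ := QueryTree.bisect_spec g (cutBelow P H) L 0 (by rw [h0]; exact hc)
        (by rw [zero_add]; exact hfar _ (hbd.trans hL))
      simp only [if_true, QueryTree.run_bind, QueryTree.numQueries_bind,
        QueryTree.numQueries_bisect]
      generalize (QueryTree.bisect (cutBelow P H) L 0).run g = m at ht hf ⊢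
      have hmb : m < b := by
        by_contra h
        simp [hfar m (by omega)] at ht
      have hmd : m < d := by omega
      -- Otherwise raising the threshold past `m` would remove nothing, and the value could not
      -- drop.
      have hkey : (⟨m, hmd⟩ : Fin d) ∉ H ∧ (⟨m, hmd⟩ : Fin d) ∉ P := by
        by_contra h
        have : cutBelow P H m ⊆ cutBelow P H (m + 1) := by
          intro i
          simp only [mem_cutBelow]
          rintro ⟨h₁, h₂⟩
          refine ⟨h₁, ?_⟩
          by_cases hi : i = ⟨m, hmd⟩
          · subst hi; tauto
          · have : i.val ≠ m := fun e => hi (Fin.ext e)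
            exact h₂.imp id (by omega)
        simp [up this ht] at hf
      -- Putting `m` into `H` deletes it from the cut, so the new witness is the false side of the
      -- drop; adding `m` back gives the true side.
      have hcut : cutBelow P (insert ⟨m, hmd⟩ H) m = cutBelow P H (m + 1) := by
        ext i
        simp only [mem_cutBelow, Finset.mem_insert, not_or]
        by_cases hi : i = ⟨m, hmd⟩
        · subst hi; simp [hkey.2]
        · have : i.val ≠ m := fun e => hi (Fin.ext e)
          have : m ≤ i.val ↔ m + 1 ≤ i.val := by omega
          simp [hi, this]
      have hins : insert ⟨m, hmd⟩ (cutBelow P H (m + 1)) = cutBelow P H m := by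
        ext i
        simp only [mem_cutBelow, Finset.mem_insert]
        by_cases hi : i = ⟨m, hmd⟩
        · subst hi; simp [hkey.1]
        · have : i.val ≠ m := fun e => hi (Fin.ext e)
          have : m ≤ i.val ↔ m + 1 ≤ i.val := by omega
          simp [hi, this]
      rw [dif_pos hmd]
      obtain ⟨r₁, r₂, r₃, r₄⟩ := ih (insert ⟨m, hmd⟩ H) m (by omega) hmd.le
        (Finset.disjoint_insert_left.2 ⟨hkey.2, hPH⟩) (by rw [hcut]; exact hf) (by
          intro h hh
          rw [hcut]
          rcases Finset.mem_insert.1 hh with rfl | hh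
          · rw [hins]; exact ht
          · exact up (Finset.insert_subset_insert _ (anti hmb)) (hsens h hh))
      refine ⟨r₁, r₂, r₃, ?_⟩
      rw [Finset.card_insert_of_notMem hkey.1, add_mul] at r₄
      omega

/-- The one-element extensions of `P` by the elements of a hitting set disjoint from `P`. -/
noncomputable def extend (L : ℕ) (P : Finset (Fin d)) :
    QueryTree (Finset (Fin d)) (List (Finset (Fin d))) :=
  (hittingSet L P d ∅).bind fun H => .output (H.toList.map (insert · P))

/-- The extensions of a set of value `false` include one below every larger set of value `true`. -/
theorem extend_spec {g : Finset (Fin d) → Bool} (hg : Monotone g) {s : ℕ}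
    (hs : ∀ D H : Finset (Fin d), g D = false → (∀ h ∈ H, g (insert h D) = true) → H.card ≤ s)
    {L : ℕ} (hL : d ≤ 2 ^ L) {P : Finset (Fin d)} (hP : g P = false) :
    (∀ Q ∈ (extend L P).run g, Q.card = P.card + 1) ∧
      (∀ D, P ⊆ D → g D = true → ∃ Q ∈ (extend L P).run g, Q ⊆ D) ∧
      ((extend L P).run g).length ≤ s ∧ (extend L P).numQueries g ≤ s * (L + 1) + 1 := by
  have hcut : cutBelow P ∅ d = P := by ext i; simp [mem_cutBelow]
  obtain ⟨h₁, h₂, h₃, h₄⟩ := hittingSet_spec hg hs hL d ∅ d le_rfl le_rfl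
    (Finset.disjoint_empty_left P) (by rwa [hcut]) (by simp)
  simp only [extend, QueryTree.run_bind, QueryTree.numQueries_bind, QueryTree.run_output,
    QueryTree.numQueries_output, List.length_map, Finset.length_toList, List.mem_map,
    Finset.mem_toList]
  generalize (hittingSet L P d ∅).run g = H at h₁ h₂ h₃ h₄ ⊢
  refine ⟨?_, ?_, h₃, ?_⟩
  · rintro _ ⟨i, hi, rfl⟩
    exact Finset.card_insert_of_notMem (Finset.disjoint_left.1 h₂ hi)
  · intro D hPD hD
    have : ¬ D ⊆ Hᶜ := by
      intro h
      have : g Hᶜ = true := hg h hD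
      simp [h₁] at this
    obtain ⟨i, hiD, hi⟩ := Finset.not_subset.1 this
    exact ⟨_, ⟨i, by simpa using hi, rfl⟩, Finset.insert_subset hiD hPD⟩
  · have := Nat.mul_le_mul_right (L + 1) h₃
    simp only [Finset.card_empty, zero_mul] at h₄
    omega

/-- Test a single set, keeping it when its value is `true`. -/
def keepIfTrue (Q : Finset (Fin d)) : QueryTree (Finset (Fin d)) (List (Finset (Fin d))) :=
  .query Q fun r => .output (if r then [Q] else [])

/-- Breadth-first search, level by level, for the smallest sets of value `true`. -/
noncomputable def levelSearch (L : ℕ) :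
    ℕ → List (Finset (Fin d)) → QueryTree (Finset (Fin d)) (Finset (Finset (Fin d)))
  | 0, _ => .output ∅
  | n + 1, Ps => (QueryTree.traverse (extend L) Ps).bind fun Qs =>
      (QueryTree.traverse keepIfTrue Qs.flatten).bind fun Rs =>
        if Rs.flatten = [] then levelSearch L n Qs.flatten else .output Rs.flatten.toFinset

/-- While `j < k` all stored sets are false, hence can be extended. At size `k`, a stored set below
an optimal set equals it, so filtering by value yields exactly the optimal sets. -/
theorem levelSearch_spec {g : Finset (Fin d) → Bool} (hg : Monotone g) {s : ℕ} (hs₀ : 1 ≤ s)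
    (hs : ∀ D H : Finset (Fin d), g D = false → (∀ h ∈ H, g (insert h D) = true) → H.card ≤ s)
    {L : ℕ} (hL : d ≤ 2 ^ L) {k : ℕ} (hk : ∀ D, g D = true → k ≤ D.card)
    (hk' : ∃ D, g D = true ∧ D.card = k) (n j : ℕ) (Ps : List (Finset (Fin d))) (hjk : j < k)
    (hn : k ≤ n + j) (hcard : ∀ P ∈ Ps, P.card = j) (hlen : Ps.length ≤ s ^ j)
    (hbelow : ∀ D, g D = true → D.card = k → ∃ P ∈ Ps, P ⊆ D) :
    (levelSearch L n Ps).run g = Finset.univ.filter (fun D => g D = true ∧ D.card = k) ∧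
      (levelSearch L n Ps).numQueries g ≤ (k - j) * (s ^ k * (L + 3)) := by
  induction n generalizing j Ps with
  | zero => omega
  | succ n ih =>
    have hfalse : ∀ P ∈ Ps, g P = false := by
      intro P hP
      by_contra h
      have := hk P (by simpa using h)
      have := hcard P hP
      omega
    have hext := fun P hP => extend_spec hg hs hL (hfalse P hP)
    have hkeep : ∀ l : List (Finset (Fin d)),
        (l.map fun Q => (keepIfTrue Q).run g).flatten = l.filter g := by
      intro l
      induction l with
      | nil => rfl
      | cons Q l ih =>
        rw [List.map_cons, List.flatten_cons, ih, List.filter_cons]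
        simp only [keepIfTrue, QueryTree.run_query, QueryTree.run_output]
        split <;> simp
    have hcost₁ := QueryTree.numQueries_traverse_le g (extend L) Ps _ fun P hP => (hext P hP).2.2.2
    simp only [levelSearch, QueryTree.run_bind, QueryTree.numQueries_bind, QueryTree.run_traverse,
      hkeep]
    have hQcard : ∀ Q ∈ (Ps.map fun P => (extend L P).run g).flatten, Q.card = j + 1 := by
      intro Q hQ
      simp only [List.mem_flatten, List.mem_map] at hQ
      obtain ⟨_, ⟨P, hP, rfl⟩, hQ⟩ := hQ
      rw [(hext P hP).1 Q hQ, hcard P hP]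
    have hQbelow : ∀ D, g D = true → D.card = k →
        ∃ Q ∈ (Ps.map fun P => (extend L P).run g).flatten, Q ⊆ D := by
      intro D hD hDk
      obtain ⟨P, hP, hPD⟩ := hbelow D hD hDk
      obtain ⟨Q, hQ, hQD⟩ := (hext P hP).2.1 D hPD hD
      exact ⟨Q, List.mem_flatten.2 ⟨_, List.mem_map.2 ⟨P, hP, rfl⟩, hQ⟩, hQD⟩
    have hQlen : (Ps.map fun P => (extend L P).run g).flatten.length ≤ s ^ (j + 1) := by
      rw [List.length_flatten, List.map_map, pow_succ]
      refine (List.sum_le_card_nsmul _ s ?_).trans ?_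
      · simp only [List.mem_map]
        rintro _ ⟨P, hP, rfl⟩
        exact (hext P hP).2.2.1
      · simpa using Nat.mul_le_mul_right s hlen
    generalize (Ps.map fun P => (extend L P).run g).flatten = Qs at hQcard hQbelow hQlen ⊢
    have hcost₂ := QueryTree.numQueries_traverse_le g keepIfTrue Qs 1
      fun Q _ => by simp [keepIfTrue]
    have hpow : s ^ (j + 1) ≤ s ^ k := Nat.pow_le_pow_right hs₀ hjk
    have hpow' : s ^ j ≤ s ^ k := Nat.pow_le_pow_right hs₀ hjk.le
    -- At most `s ^ j` extensions of cost `s * (L + 1) + 1`, then at most `s ^ (j + 1)` single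
    -- tests.
    have hcost : (QueryTree.traverse (extend L) Ps).numQueries g +
        (QueryTree.traverse keepIfTrue Qs).numQueries g ≤ s ^ k * (L + 3) := by
      have e₁ := Nat.mul_le_mul_right (s * (L + 1) + 1) hlen
      have e₂ := Nat.mul_le_mul_right (L + 1) hpow
      have e₃ : s ^ j * (s * (L + 1) + 1) = s ^ (j + 1) * (L + 1) + s ^ j := by ring
      have e₄ : s ^ k * (L + 3) = s ^ k * (L + 1) + s ^ k + s ^ k := by ring
      omega
    obtain ⟨t, rfl⟩ : ∃ t, k = j + 1 + t := ⟨k - (j + 1), by omega⟩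
    rw [show j + 1 + t - j = t + 1 by omega, add_mul, one_mul]
    split
    · next hnil =>
      have hnone : ∀ Q ∈ Qs, g Q = false := by simpa using hnil
      have ht : 0 < t := by
        by_contra h
        obtain ⟨D, hD, hDk⟩ := hk'
        obtain ⟨Q, hQ, hQD⟩ := hQbelow D hD hDk
        have := Finset.eq_of_subset_of_card_le hQD (by rw [hQcard Q hQ, hDk]; omega)
        rw [this] at hQ
        simp [hnone D hQ] at hD
      obtain ⟨r₁, r₂⟩ := ih (j + 1) Qs (by omega) (by omega) hQcard hQlen hQbelow
      rw [show j + 1 + t - (j + 1) = t by omega] at r₂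
      exact ⟨r₁, by omega⟩
    · next hne =>
      have ht : t = 0 := by
        obtain ⟨Q, hQ⟩ := List.exists_mem_of_ne_nil _ hne
        rw [List.mem_filter] at hQ
        have := hk Q hQ.2
        have := hQcard Q hQ.1
        omega
      subst ht
      refine ⟨?_, by simp only [QueryTree.numQueries_output]; omega⟩
      ext D
      simp only [QueryTree.run_output, List.mem_toFinset, List.mem_filter, Finset.mem_filter,
        Finset.mem_univ, true_and]
      constructor
      · rintro ⟨h₁, h₂⟩
        exact ⟨h₂, hQcard D h₁⟩
      · rintro ⟨h₁, h₂⟩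
        obtain ⟨Q, hQ, hQD⟩ := hQbelow D h₁ h₂
        have := Finset.eq_of_subset_of_card_le hQD (by rw [hQcard Q hQ, h₂])
        exact ⟨this ▸ hQ, h₁⟩

end Cube

/-! ### From monotone models on `X^d` to set functions. -/

section Reduction

variable {X : Type*} [PartialOrder X] [BoundedOrder X] {d : ℕ}

/-- Move the features in `D` to the extreme value on the side opposite to the label `b`. -/
def extremePoint (b : Bool) (x : Fin d → X) (D : Finset (Fin d)) : Fin d → X :=
  fun i => if i ∈ D then (if b then ⊥ else ⊤) else x i

theorem extremePoint_insert (b : Bool) (x : Fin d → X) (D : Finset (Fin d)) (i : Fin d) :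
    extremePoint b x (insert i D) =
      Function.update (extremePoint b x D) i (if b then ⊥ else ⊤) := by
  ext j
  by_cases h : j = i
  · subst h; simp [extremePoint]
  · simp [extremePoint, h]

theorem extremePoint_erase (b : Bool) (x : Fin d → X) (D : Finset (Fin d)) (i : Fin d) :
    extremePoint b x (D.erase i) = Function.update (extremePoint b x D) i (x i) := by
  ext j
  by_cases h : j = i
  · subst h; simp [extremePoint]
  · simp [extremePoint, h]

/-- Whether moving the features in `D` to the extreme value changes the label of `x`. -/
def flips (f : (Fin d → X) → Bool) (x : Fin d → X) (D : Finset (Fin d)) : Bool :=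
  f (extremePoint (f x) x D) ^^ f x

theorem flips_eq_true_iff (f : (Fin d → X) → Bool) (x : Fin d → X) (D : Finset (Fin d)) :
    flips f x D = true ↔ IsCounterfactual f x (extremePoint (f x) x D) := by
  unfold flips IsCounterfactual
  cases f x <;> cases f (extremePoint _ x D) <;> simp

theorem flips_of_featureDiff_subset {f : (Fin d → X) → Bool} (hf : Monotone f)
    {x x' : Fin d → X} {D : Finset (Fin d)} (hx' : IsCounterfactual f x x')
    (hD : featureDiff x x' ⊆ D) : flips f x D = true := by
  have hout : ∀ i, i ∉ D → x' i = x i := by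
    intro i hi
    by_contra h
    exact hi (hD (by simpa [featureDiff] using Ne.symm h))
  unfold IsCounterfactual at hx'
  unfold flips
  cases hb : f x with
  | false =>
    have hx : f x' = true := by cases h : f x' <;> simp_all
    have hle : x' ≤ extremePoint false x D := by
      intro i
      by_cases hi : i ∈ D
      · simp [extremePoint, hi]
      · simp [extremePoint, hi, hout i hi]
    have : f (extremePoint false x D) = true := hf hle hx
    simp [this]
  | true =>
    have hx : f x' = false := by cases h : f x' <;> simp_all
    have hle : extremePoint true x D ≤ x' := by
      intro i
      by_cases hi : i ∈ D
      · simp [extremePoint, hi]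
      · simp [extremePoint, hi, hout i hi]
    have := hf hle
    rw [hx] at this
    simp [le_bot_iff.1 this]

theorem featureDiff_extremePoint_subset (b : Bool) (x : Fin d → X) (D : Finset (Fin d)) :
    featureDiff x (extremePoint b x D) ⊆ D := by
  classical
  intro i hi
  by_contra h
  exact (Finset.mem_filter.1 hi).2 (by simp [extremePoint, h])

theorem flips_monotone {f : (Fin d → X) → Bool} (hf : Monotone f) (x : Fin d → X) :
    Monotone (flips f x) := by
  intro D E hDE h
  exact flips_of_featureDiff_subset hf ((flips_eq_true_iff f x D).1 h)
    ((featureDiff_extremePoint_subset _ x D).trans hDE)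

omit [PartialOrder X] [BoundedOrder X] in
theorem complexity_le {f : (Fin d → X) → Bool} {x x' : Fin d → X}
    (h : IsCounterfactual f x x') : complexity f x ≤ (featureDiff x x').card :=
  Nat.sInf_le ⟨x', h, rfl⟩

omit [PartialOrder X] [BoundedOrder X] in
theorem exists_isOptimal {f : (Fin d → X) → Bool} {x : Fin d → X}
    (h : ∃ x', IsCounterfactual f x x') : ∃ x', IsOptimal f x x' := by
  obtain ⟨x', hx'⟩ := h
  exact Nat.sInf_mem (s := {k : ℕ | ∃ x', IsCounterfactual f x x' ∧ (featureDiff x x').card = k})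
    ⟨_, x', hx', rfl⟩

theorem complexity_le_card_of_flips {f : (Fin d → X) → Bool} {x : Fin d → X}
    {D : Finset (Fin d)} (h : flips f x D = true) : complexity f x ≤ D.card :=
  (complexity_le ((flips_eq_true_iff f x D).1 h)).trans
    (Finset.card_le_card (featureDiff_extremePoint_subset _ x D))

theorem optimalSets_eq {f : (Fin d → X) → Bool} (hf : Monotone f) (x : Fin d → X) :
    optimalSets f x =
      Finset.univ.filter fun D => flips f x D = true ∧ D.card = complexity f x := by
  ext D
  simp only [optimalSets, Finset.mem_filter, Finset.mem_univ, true_and]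
  constructor
  · rintro ⟨x', hx', rfl⟩
    exact ⟨flips_of_featureDiff_subset hf hx'.1 subset_rfl, hx'.2⟩
  · rintro ⟨h₁, h₂⟩
    have hcf := (flips_eq_true_iff f x D).1 h₁
    have heq := Finset.eq_of_subset_of_card_le (featureDiff_extremePoint_subset (f x) x D)
      (h₂ ▸ complexity_le hcf)
    exact ⟨_, ⟨hcf, by rw [heq, h₂]⟩, heq⟩

omit [PartialOrder X] [BoundedOrder X] in
theorem card_le_sensitivity {f : (Fin d → X) → Bool} (y : Fin d → X) {H : Finset (Fin d)}
    (h : ∀ i ∈ H, ∃ a, f y ≠ f (Function.update y i a)) : H.card ≤ sensitivity f := by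
  classical
  have hbdd : BddAbove (Set.range (sensitivityAt f)) := by
    refine ⟨d, ?_⟩
    rintro _ ⟨z, rfl⟩
    exact (Finset.card_le_univ _).trans (Fintype.card_fin d).le
  refine le_trans (Finset.card_le_card fun i hi => ?_) (le_ciSup hbdd y)
  exact Finset.mem_filter.2 ⟨Finset.mem_univ i, h i hi⟩

theorem card_le_sensitivity_of_flips_insert {f : (Fin d → X) → Bool} {x : Fin d → X}
    (D H : Finset (Fin d)) (hD : flips f x D = false)
    (hH : ∀ i ∈ H, flips f x (insert i D) = true) : H.card ≤ sensitivity f := by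
  refine card_le_sensitivity (extremePoint (f x) x D) fun i hi =>
    ⟨if f x then ⊥ else ⊤, fun h => ?_⟩
  have := hH i hi
  rw [flips, extremePoint_insert, ← h, ← flips, hD] at this
  exact Bool.false_ne_true this

/-- At the extreme point over an optimal set, restoring any one moved feature undoes the flip, by
minimality; so all of them are sensitive there. -/
theorem complexity_le_sensitivity {f : (Fin d → X) → Bool} (hf : Monotone f) {x : Fin d → X}
    (h : ∃ x', IsCounterfactual f x x') : complexity f x ≤ sensitivity f := by
  obtain ⟨x', hx', hk⟩ := exists_isOptimal h
  have hD := flips_of_featureDiff_subset hf hx' subset_rfl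
  rw [← hk]
  refine card_le_sensitivity (extremePoint (f x) x (featureDiff x x')) fun i hi => ⟨x i, fun h => ?_⟩
  rw [flips, h, ← extremePoint_erase, ← flips] at hD
  have := complexity_le_card_of_flips hD
  rw [Finset.card_erase_of_mem hi] at this
  have := Finset.card_pos.2 ⟨i, hi⟩
  omega

omit [PartialOrder X] [BoundedOrder X] in
theorem complexity_pos {f : (Fin d → X) → Bool} {x : Fin d → X}
    (h : ∃ x', IsCounterfactual f x x') : 0 < complexity f x := by
  obtain ⟨x', hx', hk⟩ := exists_isOptimal h
  rw [← hk, Finset.card_pos]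
  by_contra hne
  refine hx' (congrArg f (funext fun i => ?_))
  by_contra hi
  exact hne ⟨i, by simpa [featureDiff] using hi⟩

/-- The search for optimal counterfactuals: learn the label of `x`, then search among the points
that move a set of features of `x` to the extreme value opposite to that label. -/
noncomputable def findOptimalSets (x : Fin d → X) :
    QueryTree (Fin d → X) (Finset (Finset (Fin d))) :=
  -- Here `log d = 0` allows no query. A counterfactual forces `d = 1`, and the answer is then
  -- known.
  if d ≤ 1 then .output {Finset.univ}
  else .query x fun b =>
    (levelSearch (Nat.clog 2 d) d [∅]).translate (extremePoint b x) b

theorem findOptimalSets_spec {f : (Fin d → X) → Bool} (hf : Monotone f) {x : Fin d → X}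
    (h : ∃ x', IsCounterfactual f x x') :
    (findOptimalSets x).run f = optimalSets f x ∧
      (findOptimalSets x).numQueries f ≤
        if d ≤ 1 then 0
        else complexity f x * (sensitivity f ^ complexity f x * (Nat.clog 2 d + 3)) + 1 := by
  have hpos := complexity_pos h
  obtain ⟨x', hx', hk⟩ := exists_isOptimal h
  have hflip := flips_of_featureDiff_subset hf hx' subset_rfl
  have hkd : complexity f x ≤ d := by
    rw [← hk]
    exact (Finset.card_le_univ _).trans (Fintype.card_fin d).le
  unfold findOptimalSets
  split
  · next hd =>
    refine ⟨?_, le_rfl⟩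
    have huniv : ∀ D : Finset (Fin d), D.card = complexity f x ↔ D = Finset.univ := by
      intro D
      rw [← Finset.card_eq_iff_eq_univ, Fintype.card_fin]
      omega
    rw [optimalSets_eq hf]
    ext D
    simp only [QueryTree.run_output, Finset.mem_singleton, Finset.mem_filter, Finset.mem_univ,
      true_and, huniv]
    refine ⟨fun e => ⟨?_, e⟩, fun e => e.2⟩
    rw [e, ← (huniv _).1 hk]
    exact hflip
  · obtain ⟨r₁, r₂⟩ := levelSearch_spec (flips_monotone hf x)
      (hpos.trans_le (complexity_le_sensitivity hf h)) card_le_sensitivity_of_flips_insert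
      (Nat.le_pow_clog one_lt_two d) (fun D => complexity_le_card_of_flips)
      ⟨_, hflip, hk⟩ d 0 [∅] hpos (by omega) (by simp) (by simp) (by simp)
    rw [optimalSets_eq hf]
    simp only [QueryTree.run_query, QueryTree.numQueries_query, QueryTree.run_translate,
      QueryTree.numQueries_translate]
    exact ⟨r₁, Nat.succ_le_succ r₂⟩

theorem numQueries_findOptimalSets_le {f : (Fin d → X) → Bool} (hf : Monotone f)
    {x : Fin d → X} (h : ∃ x', IsCounterfactual f x x') :
    ((findOptimalSets x).numQueries f : ℝ) ≤
      9 * (sensitivity f : ℝ) ^ (9 * complexity f x) * Real.log d := by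
  have hq := (findOptimalSets_spec hf h).2
  have hk := complexity_pos h
  have hks := complexity_le_sensitivity hf h
  generalize (findOptimalSets x).numQueries f = q at hq ⊢
  generalize complexity f x = k at *
  generalize sensitivity f = s at *
  split at hq
  · obtain rfl : q = 0 := by omega
    simp only [Nat.cast_zero]
    have := Real.log_natCast_nonneg d
    positivity
  · next hd =>
    have hs : 1 ≤ s := by omega
    have h₁ : k * s ^ k ≤ s ^ (9 * k) := by
      calc k * s ^ k ≤ s * s ^ k := Nat.mul_le_mul_right _ hks
        _ = s ^ (k + 1) := by ring
        _ ≤ s ^ (9 * k) := Nat.pow_le_pow_right hs (by omega)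
    have h₂ : q ≤ s ^ (9 * k) * (Nat.clog 2 d + 4) := by
      have h₃ : 1 ≤ s ^ (9 * k) := Nat.one_le_pow _ _ hs
      have h₄ := Nat.mul_le_mul_right (Nat.clog 2 d + 3) h₁
      rw [← mul_assoc] at hq
      rw [show s ^ (9 * k) * (Nat.clog 2 d + 4) =
        s ^ (9 * k) * (Nat.clog 2 d + 3) + s ^ (9 * k) by ring]
      omega
    have hlog : Real.log 2 ≤ Real.log d :=
      Real.log_le_log two_pos (by exact_mod_cast (show 2 ≤ d by omega))
    have hclog : ((Nat.clog 2 d : ℝ) - 1) * Real.log 2 ≤ Real.log d := by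
      have hlt : 2 ^ (Nat.clog 2 d - 1) < d := by
        simpa using Nat.pow_pred_clog_lt_self one_lt_two (by omega : 1 < d)
      have hc : 1 ≤ Nat.clog 2 d := Nat.clog_pos one_lt_two (by omega)
      have := Real.log_le_log (by positivity)
        (show ((2 : ℝ) ^ (Nat.clog 2 d - 1)) ≤ d by exact_mod_cast hlt.le)
      rwa [Real.log_pow, Nat.cast_sub hc, Nat.cast_one] at this
    -- As `clog ≤ log d / log 2 + 1` and `log d ≥ log 2`, the left side is at most `6 log d / log
    -- 2`, and `6 / log 2 < 9`.
    have hfac : (Nat.clog 2 d : ℝ) + 4 ≤ 9 * Real.log d := by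
      have := Real.log_two_gt_d9
      nlinarith
    calc (q : ℝ) ≤ (s : ℝ) ^ (9 * k) * (Nat.clog 2 d + 4) := by exact_mod_cast h₂
      _ ≤ (s : ℝ) ^ (9 * k) * (9 * Real.log d) := by gcongr
      _ = 9 * (s : ℝ) ^ (9 * k) * Real.log d := by ring

end Reduction

end Counterfactual

theorem theorem1p3 (c : ℕ) :
    ∃ C : ℕ, ∀ (X : Type*) [PartialOrder X] [BoundedOrder X] (d : ℕ),
      ∃ A : (Fin d → X) →
          Counterfactual.RandomizedAlgorithm (Fin d → X) (Finset (Finset (Fin d))),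
        ∀ (f : (Fin d → X) → Bool) (xstar : Fin d → X), Monotone f →
          (∃ x', Counterfactual.IsCounterfactual f xstar x') →
            (A xstar).QueriesAtMost f
              (C * (Counterfactual.sensitivity f : ℝ) ^ (C * Counterfactual.complexity f xstar)
                * Real.log d) ∧
            ENNReal.ofReal (1 - 1 / (d : ℝ) ^ c) ≤
              (A xstar).outputDist f (Counterfactual.optimalSets f xstar) := by
  refine ⟨9, fun X _ _ d => ⟨fun x => PMF.pure (Counterfactual.findOptimalSets x),
    fun f xstar hf h => ⟨?_, ?_⟩⟩⟩
  · intro t ht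
    rw [PMF.support_pure, Set.mem_singleton_iff] at ht
    subst ht
    exact_mod_cast Counterfactual.numQueries_findOptimalSets_le hf h
  · rw [Counterfactual.RandomizedAlgorithm.outputDist, PMF.pure_map,
      (Counterfactual.findOptimalSets_spec hf h).1, PMF.pure_apply_self]
    refine ENNReal.ofReal_le_one.2 (sub_le_self _ (by positivity))
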